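/- Let $\mathbb{F}$ be an algebraically closed field of characteristic $p>3$, let $m\ge 1$ be an integer, and let $B_m=\mathbb{F}[X_1,\dots,X_m]/(X_1^p,\dots,X_m^p)$ be the truncated polynomial ring. Write $x_i$ for the image of $X_i$ and $x^\alpha=x_1^{\alpha_1}\cdots x_m^{\alpha_m}$ for $\alpha\in\mathbb{N}^m$. Let $W=W(m,\mathbb{1})=\operatorname{Der}_{\mathbb{F}}(B_m)$, a Lie algebra under the commutator bracket, and let $D_1,\dots,D_m\in W$ be the partial derivatives. The algebra $W$ is graded, $W=W_{-1}\oplus\dots\oplus W_s$ with $s=m(p-1)-1$, where $W_k$ is the $\mathbb{F}$-linear span of the derivations $x^\alpha D_j$ with $1\le j\le m$ and $\alpha_1+\dots+\alpha_m=k+1$. Let $x\in W_s$ and $y\in W$, and let $L\subseteq W$ be the Lie subalgebra generated by $x$ and $y$. Then $\dim_{\mathbb{F}}[L,L]\le p^m$, where $[L,L]$ is the linear span of all brackets of two elements of $L$. -/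

import Mathlib

noncomputable section

namespace WittAlg

/-- The ideal `(X_1 ^ p, …, X_m ^ p)` of the polynomial ring `F[X_1, …, X_m]`. -/
def truncIdeal (F : Type*) [Field F] (p m : ℕ) : Ideal (MvPolynomial (Fin m) F) :=
  Ideal.span (Set.range fun i : Fin m => (MvPolynomial.X i : MvPolynomial (Fin m) F) ^ p)

/-- The truncated polynomial ring `B_m = F[X_1, …, X_m] / (X_1 ^ p, …, X_m ^ p)`. -/
abbrev TruncPoly (F : Type*) [Field F] (p m : ℕ) : Type _ :=
  MvPolynomial (Fin m) F ⧸ truncIdeal F p m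

/-- The Witt algebra `W(m, 1) = Der B_m`, with the commutator bracket. -/
abbrev Witt (F : Type*) [Field F] (p m : ℕ) : Type _ :=
  Derivation F (TruncPoly F p m) (TruncPoly F p m)

/-- The image `x ^ α = x_1 ^ α_1 ⋯ x_m ^ α_m` of a monomial in `B_m`. -/
def mono (F : Type*) [Field F] (p : ℕ) {m : ℕ} (α : Fin m → ℕ) : TruncPoly F p m :=
  ∏ i : Fin m, (Ideal.Quotient.mk (truncIdeal F p m) (MvPolynomial.X i)) ^ α i

/-- In characteristic `p` the partial derivatives of the polynomial ring preserve the ideal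
`(X_1 ^ p, …, X_m ^ p)`. -/
theorem pderiv_mem_truncIdeal (F : Type*) [Field F] (p m : ℕ) [CharP F p] (j : Fin m)
    {f : MvPolynomial (Fin m) F} (hf : f ∈ truncIdeal F p m) :
    MvPolynomial.pderiv j f ∈ truncIdeal F p m := by
  unfold truncIdeal at hf ⊢
  induction hf using Submodule.span_induction with
  | mem g hg =>
    obtain ⟨i, rfl⟩ := hg
    have h0 : MvPolynomial.pderiv j ((MvPolynomial.X i : MvPolynomial (Fin m) F) ^ p) = 0 := by
      rw [Derivation.leibniz_pow, ← Nat.cast_smul_eq_nsmul (MvPolynomial (Fin m) F),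
        CharP.cast_eq_zero, zero_smul]
    simp only [h0, Submodule.zero_mem]
  | zero => simp
  | add g h _ _ hg hh => rw [map_add]; exact add_mem hg hh
  | smul a g hg hg' =>
    rw [smul_eq_mul, Derivation.leibniz]
    exact add_mem (Ideal.mul_mem_left _ a hg') (Ideal.mul_mem_right _ _ hg)

theorem mk_pderiv_eq_zero (F : Type*) [Field F] (p m : ℕ) [CharP F p] (j : Fin m)
    (f : MvPolynomial (Fin m) F) (hf : Ideal.Quotient.mkₐ F (truncIdeal F p m) f = 0) :
    Ideal.Quotient.mkₐ F (truncIdeal F p m) (MvPolynomial.pderiv j f) = 0 :=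
  Ideal.Quotient.eq_zero_iff_mem.mpr
    (pderiv_mem_truncIdeal F p m j (Ideal.Quotient.eq_zero_iff_mem.mp hf))

/-- The partial derivative `D_j` of `B_m`, induced by the one of `F[X_1, …, X_m]`. -/
def partialD (F : Type*) [Field F] (p m : ℕ) [CharP F p] (j : Fin m) : Witt F p m :=
  Derivation.liftOfSurjective (f := Ideal.Quotient.mkₐ F (truncIdeal F p m))
    (Ideal.Quotient.mkₐ_surjective F (truncIdeal F p m))
    (d := MvPolynomial.pderiv j)
    (mk_pderiv_eq_zero F p m j)

theorem partialD_mk (F : Type*) [Field F] (p m : ℕ) [CharP F p] (j : Fin m)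
    (f : MvPolynomial (Fin m) F) :
    partialD F p m j (Ideal.Quotient.mk (truncIdeal F p m) f) =
      Ideal.Quotient.mk (truncIdeal F p m) (MvPolynomial.pderiv j f) :=
  Derivation.liftOfSurjective_apply (f := Ideal.Quotient.mkₐ F (truncIdeal F p m))
    (Ideal.Quotient.mkₐ_surjective F (truncIdeal F p m))
    (mk_pderiv_eq_zero F p m j) f

/-- The homogeneous component `W_k` of `W(m, 1)`: the span of the derivations `x ^ α D_j` with
`|α| = k + 1`. -/
def component (F : Type*) [Field F] (p m : ℕ) [CharP F p] (k : ℤ) : Submodule F (Witt F p m) :=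
  Submodule.span F {D | ∃ (α : Fin m → ℕ) (j : Fin m),
    ((∑ i, α i : ℕ) : ℤ) = k + 1 ∧ D = mono F p α • partialD F p m j}

/-- The highest degree `s = m (p - 1) - 1` of the grading of `W(m, 1)`. -/
def topDegree (p m : ℕ) : ℤ := (m : ℤ) * ((p : ℤ) - 1) - 1

/-- The derived algebra `[L, L]` of a Lie algebra `L` over `F`: the linear span of all brackets. -/
abbrev derivedAlg (F : Type*) [Field F] (L : Type*) [LieRing L] [LieAlgebra F L] : LieIdeal F L :=
  ⁅(⊤ : LieIdeal F L), (⊤ : LieIdeal F L)⁆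

end WittAlg

end

noncomputable section

namespace WittAlg

open Polynomial Module

/-! ### Frobenius powers of derivations -/

section FrobeniusPower

variable {F B : Type*} [Field F] [CommRing B] [Algebra F B]

/-! An element of top degree is `x = s • D`, where `s` is the top monomial. It spans the socle of
`B`: `s * b = ε b • s`, with `ε` the augmentation. Suppose first that the values `ε (y ^ i b)`, `i <
p ^ m`, determine `b`. Then the derivations `y ^ (p ^ i)`, `i < m`, form a `B`-basis of `W`
(`frobPow_independent`, `exists_eq_sum_frobPow`). Write `D` in this basis. Multiplication by `s`
sees only the augmentations of the coefficients, so `x = s • E`, where `E` is an `F`-combination of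
the `y ^ (p ^ i)` and hence commutes with `y`. Therefore `L` lies in `F y + B E` and `[L, L]` in `B
E`, of dimension at most `dim B = p ^ m`.

For arbitrary `y`, take the line through `y` and a toral `z` with injective jet
(`exists_toral_jet_injective`). Injectivity holds at all but finitely many points of the line, and a
lower bound on the dimension of the bracket span at `y` persists at all but finitely many points. As
`F` is infinite, the generic bound holds at `y`. -/

theorem coe_pow_comp_mul_sub [Nontrivial B] (p : ℕ) [Fact p.Prime] [CharP F p]
    (y : Derivation F B B) (i : ℕ) (a b : B) :
    ((y : End F B) ^ p ^ i) (a * b) =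
      a * ((y : End F B) ^ p ^ i) b + b * ((y : End F B) ^ p ^ i) a := by
  set Y : End F B := (y : End F B) with hY
  have hchar : CharP (End F (End F B)) p :=
    charP_of_injective_algebraMap (algebraMap F (End F (End F B))).injective p
  have hexp : ExpChar (End F (End F B)) p := ExpChar.prime Fact.out
  -- The commutator of `Y` with multiplication by `a` is multiplication by `Y a`. Left and right
  -- multiplication by `Y` commute, so the Frobenius identity turns the `p ^ i`-th power of `ad Y`
  -- into `ad (Y ^ p ^ i)`.
  have had : ∀ n : ℕ, ((LinearMap.mulLeft F Y - LinearMap.mulRight F Y) ^ n)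
      (LinearMap.mulLeft F a) = LinearMap.mulLeft F ((Y ^ n) a) := by
    intro n
    induction n with
    | zero => simp
    | succ n ih =>
      rw [pow_succ', Module.End.mul_apply, ih, pow_succ', Module.End.mul_apply]
      ext c
      simp [hY, mul_comm]
  have h := had (p ^ i)
  have hsub : ∀ A C : End F (End F B), Commute A C →
      (A - C) ^ p ^ i = A ^ p ^ i - C ^ p ^ i :=
    fun A C hAC => sub_pow_expChar_pow_of_commute (R := End F (End F B)) p i hAC
  replace h := (LinearMap.congr_fun (hsub _ _ (LinearMap.commute_mulLeft_right Y Y)) _).symm.trans h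
  rw [LinearMap.pow_mulLeft, LinearMap.pow_mulRight] at h
  have h2 := LinearMap.congr_fun h b
  simp only [LinearMap.sub_apply, LinearMap.mulLeft_apply, LinearMap.mulRight_apply,
    Module.End.mul_apply] at h2
  rw [sub_eq_iff_eq_add.mp h2]
  ring

/-- The iterate `y ^ (p ^ i)` of a derivation `y` in characteristic `p`, as a derivation. -/
def frobPow [Nontrivial B] (p : ℕ) [Fact p.Prime] [CharP F p]
    (y : Derivation F B B) (i : ℕ) : Derivation F B B :=
  Derivation.mk' ((y : End F B) ^ p ^ i) (coe_pow_comp_mul_sub p y i)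

variable [Nontrivial B] (p : ℕ) [Fact p.Prime] [CharP F p] (y : Derivation F B B)

theorem frobPow_apply (i : ℕ) (b : B) : frobPow p y i b = ((y : End F B) ^ p ^ i) b := rfl

theorem lie_frobPow (i : ℕ) : ⁅y, frobPow p y i⁆ = 0 := by
  ext b
  have h : y (((y : End F B) ^ p ^ i) b) = ((y : End F B) ^ p ^ i) (y b) := by
    have := LinearMap.congr_fun (pow_mul_comm' (y : End F B) (p ^ i)) b
    simpa using this.symm
  simp [Derivation.commutator_apply, frobPow_apply, h]

omit [Nontrivial B] in
theorem lie_smul_derivation (E : Derivation F B B) (b : B) :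
    ⁅y, b • E⁆ = y b • E + b • ⁅y, E⁆ := by
  ext c
  simp [Derivation.commutator_apply]
  ring

omit [Nontrivial B] in
theorem lie_smul_scalar (E : Derivation F B B) (r : F) : ⁅y, r • E⁆ = r • ⁅y, E⁆ := by
  ext c
  simp [Derivation.commutator_apply, smul_sub]

/-! ### Derivations with injective jets -/

/-- The vector of the values at the point `ε` of the first `n` iterates of `y`. -/
def jet (ε : B →ₐ[F] F) (n : ℕ) (y : Derivation F B B) : B →ₗ[F] (Fin n → F) :=
  LinearMap.pi fun i => ε.toLinearMap ∘ₗ ((y : End F B) ^ (i : ℕ))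

omit [Nontrivial B] in
theorem jet_apply (ε : B →ₐ[F] F) (n : ℕ) (y : Derivation F B B) (b : B) (i : Fin n) :
    jet ε n y b i = ε (((y : End F B) ^ (i : ℕ)) b) := rfl

omit [Nontrivial B] in
theorem eq_zero_of_jet {ε : B →ₐ[F] F} {n : ℕ} {y : Derivation F B B}
    (h : Function.Injective (jet ε n y)) {b : B}
    (hb : ∀ i, ε (((y : End F B) ^ i) b) = 0) : b = 0 := by
  apply h
  ext i
  simp [jet_apply, hb]

/-- Since `y` commutes with its Frobenius powers, bracketing a relation with `y` only differentiates
its coefficients. -/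
theorem frobPow_relation (n : ℕ) (b : ℕ → B) (k : ℕ)
    (h : ∑ i ∈ Finset.range k, b i • frobPow p y i = 0) :
    ∑ i ∈ Finset.range k, ((y : End F B) ^ n) (b i) • frobPow p y i = 0 := by
  induction n with
  | zero => simpa using h
  | succ n ih =>
    have := congrArg (fun D => ⁅y, D⁆) ih
    simp only [lie_sum, lie_smul_derivation, lie_frobPow, smul_zero, add_zero, lie_zero] at this
    simpa [pow_succ'] using this

/-- A derivation whose `p ^ m`-jets separate the points of an algebra of dimension `p ^ m` has
linearly independent Frobenius powers. -/
theorem frobPow_independent [FiniteDimensional F B] {ε : B →ₐ[F] F}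
    (hloc : ∀ b, ε b ≠ 0 → IsUnit b) {m : ℕ} (hdim : finrank F B = p ^ m)
    (hy : Function.Injective (jet ε (p ^ m) y)) (k : ℕ) (hk : k ≤ m) (b : ℕ → B)
    (h : ∑ i ∈ Finset.range k, b i • frobPow p y i = 0) : ∀ i < k, b i = 0 := by
  induction k generalizing b with
  | zero => intro i hi; omega
  | succ k ih =>
    by_cases hbk : b k = 0
    · rw [Finset.sum_range_succ, hbk, zero_smul, add_zero] at h
      intro i hi
      rcases Nat.lt_succ_iff_lt_or_eq.mp hi with hi | rfl
      · exact ih (by omega) b h i hi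
      · exact hbk
    · exfalso
      -- Differentiating often enough makes the leading coefficient a unit, so the relation can be
      -- normalised to `c k = 1`.
      obtain ⟨n, hn⟩ : ∃ n, ε (((y : End F B) ^ n) (b k)) ≠ 0 := by
        by_contra! hcon
        exact hbk (eq_zero_of_jet hy hcon)
      obtain ⟨v, hv⟩ := (hloc _ hn).exists_left_inv
      set c : ℕ → B := fun i => v * ((y : End F B) ^ n) (b i) with hc
      have hrel : ∑ i ∈ Finset.range (k + 1), c i • frobPow p y i = 0 := by
        have := congrArg (fun D => v • D) (frobPow_relation p y n b (k + 1) h)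
        simpa [Finset.smul_sum, smul_smul, hc] using this
      have hck : c k = 1 := hv
      -- One more bracket with `y` kills the leading coefficient 1 and leaves a shorter relation.
      have hyc : ∀ i < k, y (c i) = 0 := by
        apply ih (by omega)
        have := frobPow_relation p y 1 c (k + 1) hrel
        rw [Finset.sum_range_succ, hck] at this
        simpa using this
      have hconst : ∀ i < k, c i = algebraMap F B (ε (c i)) := by
        intro i hi
        rw [← sub_eq_zero]
        apply eq_zero_of_jet hy
        intro j
        cases j with
        | zero => simp
        | succ j => simp [pow_succ, hyc i hi]
      have hpow : ∀ f, ((y : End F B) ^ p ^ k) f =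
          - ∑ i ∈ Finset.range k, ε (c i) • ((y : End F B) ^ p ^ i) f := by
        intro f
        have := congrArg (fun D : Derivation F B B => D f) hrel
        rw [Finset.sum_range_succ, hck] at this
        simp only [one_smul, Derivation.add_apply, Derivation.zero_apply,
          ← Derivation.coeFnAddMonoidHom_apply, map_sum, Finset.sum_apply] at this
        simp only [Derivation.coeFnAddMonoidHom_apply, frobPow_apply, Derivation.smul_apply]
          at this
        rw [eq_neg_iff_add_eq_zero, add_comm, ← this]
        congr 1
        apply Finset.sum_congr rfl
        intro i hi
        rw [Algebra.smul_def, ← hconst i (Finset.mem_range.mp hi), smul_eq_mul]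
      -- Now `y ^ (p ^ k)` is an `F`-combination of lower iterates, so the first `p ^ k` jet entries
      -- determine all others. This is too few for dimension `p ^ m`.
      have hinj : Function.Injective (jet ε (p ^ k) y) := by
        rw [injective_iff_map_eq_zero]
        intro f hf
        apply eq_zero_of_jet hy
        intro j
        induction j using Nat.strong_induction_on with
        | _ j ihj =>
          by_cases hj : j < p ^ k
          · exact congrFun hf ⟨j, hj⟩
          · obtain ⟨l, rfl⟩ := Nat.exists_eq_add_of_le (not_lt.mp hj)
            rw [pow_add, Module.End.mul_apply, hpow, map_neg, map_sum, neg_eq_zero]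
            apply Finset.sum_eq_zero
            intro i hi
            rw [map_smul, ← Module.End.mul_apply, ← pow_add, ihj, smul_zero]
            have := Nat.pow_lt_pow_right (Fact.out : p.Prime).one_lt (Finset.mem_range.mp hi)
            omega
      have hle := LinearMap.finrank_le_finrank_of_injective hinj
      rw [hdim, Module.finrank_fintype_fun_eq_card, Fintype.card_fin] at hle
      have := Nat.pow_lt_pow_right (Fact.out : p.Prime).one_lt (show k < m by omega)
      omega

/-- Dimension count: `B ^ m` embeds in the derivations through the Frobenius powers, and these embed
in `B ^ m` by evaluation at `X`. The composite is an injective endomorphism of a finite-dimensional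
space, hence onto. -/
theorem exists_eq_sum_frobPow [FiniteDimensional F B] {ε : B →ₐ[F] F}
    (hloc : ∀ b, ε b ≠ 0 → IsUnit b) {m : ℕ} (hdim : finrank F B = p ^ m)
    (hy : Function.Injective (jet ε (p ^ m) y)) (X : Fin m → B)
    (hX : ∀ D : Derivation F B B, (∀ i, D (X i) = 0) → D = 0) (D : Derivation F B B) :
    ∃ b : Fin m → B, D = ∑ i, b i • frobPow p y i := by
  let toDer : (Fin m → B) →ₗ[F] Derivation F B B :=
    { toFun := fun b => ∑ i, b i • frobPow p y i
      map_add' := fun a b => by simp [add_smul, Finset.sum_add_distrib]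
      map_smul' := fun r b => by simp [Finset.smul_sum] }
  let coord : Derivation F B B →ₗ[F] (Fin m → B) :=
    { toFun := fun D i => D (X i)
      map_add' := fun _ _ => rfl
      map_smul' := fun _ _ => rfl }
  have hcoord : Function.Injective coord := by
    rw [injective_iff_map_eq_zero]
    exact fun D hD => hX D fun i => congrFun hD i
  have htoDer : Function.Injective toDer := by
    rw [injective_iff_map_eq_zero]
    intro b hb
    have hb' : ∑ i ∈ Finset.range m, (fun i => if h : i < m then b ⟨i, h⟩ else 0) i •
        frobPow p y i = 0 := by
      rw [Finset.sum_range]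
      simpa using (show ∑ i, b i • frobPow p y i = 0 from hb)
    have := frobPow_independent p y hloc hdim hy m le_rfl _ hb'
    ext i
    simpa using this i i.2
  have hsurj : Function.Surjective (coord ∘ₗ toDer) :=
    LinearMap.surjective_of_injective (hcoord.comp htoDer)
  obtain ⟨b, hb⟩ := hsurj (coord D)
  exact ⟨b, (hcoord hb).symm⟩

end FrobeniusPower

/-! ### The derived algebra of a two-generated subalgebra -/

section Generic

variable {F B : Type*} [Field F] [CommRing B] [Algebra F B]

/-- The span of all brackets of elements of the Lie subalgebra generated by `x` and `y`. -/
def bracketSpan (F : Type*) {V : Type*} [Field F] [LieRing V] [LieAlgebra F V] (x y : V) :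
    Submodule F V :=
  Submodule.span F {z | ∃ a ∈ LieSubalgebra.lieSpan F V {x, y},
    ∃ b ∈ LieSubalgebra.lieSpan F V {x, y}, ⁅a, b⁆ = z}

/-- `F y + B E` is a Lie subalgebra. The coefficients of `y` are scalars and `E` commutes with `y`,
so no bracket has a `y`-component. -/
theorem bracketSpan_le_of_commute (y E : Derivation F B B) (hE : ⁅y, E⁆ = 0) (s : B) :
    bracketSpan F (s • E) y ≤ LinearMap.range ((LinearMap.toSpanSingleton B _ E).restrictScalars F)
    := by
  set M := LinearMap.range ((LinearMap.toSpanSingleton B _ E).restrictScalars F) with hM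
  have hmem : ∀ a : B, a • E ∈ M := fun a => ⟨a, rfl⟩
  have hlie : ∀ a b : B, ∀ r t : F, ⁅r • y + a • E, t • y + b • E⁆ ∈ M := by
    intro a b r t
    have h1 : ⁅r • y + a • E, t • y + b • E⁆ =
        (r • y b - t • y a + (a * E b - b * E a)) • E := by
      ext c
      have hc : E (y c) = y (E c) := by
        have := congrArg (fun D : Derivation F B B => D c) hE
        exact (sub_eq_zero.mp this).symm
      simp only [Derivation.commutator_apply, Algebra.smul_def (R := F) (A := B), Derivation.add_apply,
        Derivation.smul_apply, smul_eq_mul, Derivation.leibniz, map_add,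
        Derivation.map_algebraMap, hc]
      ring
    rw [h1]
    exact hmem _
  let K : LieSubalgebra F (Derivation F B B) :=
    { carrier := {D | ∃ (r : F) (a : B), D = r • y + a • E}
      add_mem' := by
        rintro _ _ ⟨r, a, rfl⟩ ⟨t, b, rfl⟩
        exact ⟨r + t, a + b, by module⟩
      zero_mem' := ⟨0, 0, by simp⟩
      smul_mem' := by
        rintro c _ ⟨r, a, rfl⟩
        exact ⟨c * r, c • a, by rw [smul_add, smul_smul, smul_assoc]⟩
      lie_mem' := by
        rintro _ _ ⟨r, a, rfl⟩ ⟨t, b, rfl⟩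
        obtain ⟨c, hc⟩ := hlie a b r t
        exact ⟨0, c, by rw [← hc]; simp⟩ }
  have hK : LieSubalgebra.lieSpan F (Derivation F B B) {s • E, y} ≤ K := by
    rw [LieSubalgebra.lieSpan_le]
    rintro D (rfl | rfl)
    · exact ⟨0, s, by simp⟩
    · exact ⟨1, 0, by simp⟩
  refine Submodule.span_le.mpr ?_
  rintro _ ⟨u, hu, v, hv, rfl⟩
  obtain ⟨r, a, rfl⟩ := hK hu
  obtain ⟨t, b, rfl⟩ := hK hv
  exact hlie a b r t

theorem finrank_bracketSpan_le_of_jet [Nontrivial B] (p : ℕ) [Fact p.Prime] [CharP F p]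
    [FiniteDimensional F B] {ε : B →ₐ[F] F}
    (hloc : ∀ b, ε b ≠ 0 → IsUnit b) {m : ℕ} (hdim : finrank F B = p ^ m) (X : Fin m → B)
    (hX : ∀ D : Derivation F B B, (∀ i, D (X i) = 0) → D = 0) (s : B)
    (hs : ∀ b, s * b = ε b • s) (D y : Derivation F B B)
    (hy : Function.Injective (jet ε (p ^ m) y)) :
    finrank F (bracketSpan F (s • D) y) ≤ p ^ m := by
  obtain ⟨b, rfl⟩ := exists_eq_sum_frobPow p y hloc hdim hy X hX D
  have hE : s • ∑ i, b i • frobPow p y i = s • ∑ i, ε (b i) • frobPow p y i := by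
    simp only [Finset.smul_sum, smul_smul, hs]
    refine Finset.sum_congr rfl fun i _ => ?_
    rw [smul_assoc, smul_comm]
  rw [hE]
  have hle := bracketSpan_le_of_commute y (∑ i, ε (b i) • frobPow p y i)
    (by
      rw [lie_sum]
      exact Finset.sum_eq_zero fun i _ => by
        rw [lie_smul_scalar, lie_frobPow, smul_zero]) s
  calc _ ≤ _ := Submodule.finrank_mono hle
    _ ≤ finrank F B := LinearMap.finrank_range_le _
    _ = p ^ m := hdim

end Generic

/-! ### Polynomial families of vectors -/

section PolyFun

variable {F : Type*} [Field F] {U V Z : Type*} [AddCommGroup U] [Module F U]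
  [AddCommGroup V] [Module F V] [AddCommGroup Z] [Module F Z]

/-- The functions `F → V` that are polynomial in their argument. -/
def polyFun (F V : Type*) [Field F] [AddCommGroup V] [Module F V] : Submodule F (F → V) :=
  Submodule.span F {g | ∃ (n : ℕ) (v : V), g = fun t => t ^ n • v}

theorem monomial_mem_polyFun (n : ℕ) (v : V) : (fun t : F => t ^ n • v) ∈ polyFun F V :=
  Submodule.subset_span ⟨n, v, rfl⟩

theorem const_mem_polyFun (v : V) : (fun _ : F => v) ∈ polyFun F V := by
  simpa using monomial_mem_polyFun (F := F) 0 v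

theorem line_mem_polyFun (v w : V) : (fun t : F => (1 - t) • v + t • w) ∈ polyFun F V := by
  have h := add_mem (const_mem_polyFun (F := F) v) (monomial_mem_polyFun (F := F) 1 (w - v))
  convert h using 1
  ext t
  simp only [pow_one, Pi.add_apply]
  module

theorem linear_mem_polyFun (β : U →ₗ[F] V) {g : F → U} (hg : g ∈ polyFun F U) :
    (fun t => β (g t)) ∈ polyFun F V := by
  have hle : polyFun F U ≤ (polyFun F V).comap (β.compLeft F) := by
    refine Submodule.span_le.mpr ?_
    rintro _ ⟨n, u, rfl⟩
    refine Submodule.subset_span ⟨n, β u, ?_⟩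
    ext t
    simp
  exact hle hg

theorem pow_smul_mem_polyFun (n : ℕ) {g : F → V} (hg : g ∈ polyFun F V) :
    (fun t => t ^ n • g t) ∈ polyFun F V := by
  let T : (F → V) →ₗ[F] (F → V) :=
    { toFun := fun g t => t ^ n • g t
      map_add' := fun a b => by ext t; simp
      map_smul' := fun c a => by ext t; simp [smul_comm c] }
  have hle : polyFun F V ≤ (polyFun F V).comap T := by
    refine Submodule.span_le.mpr ?_
    rintro _ ⟨k, v, rfl⟩
    refine Submodule.subset_span ⟨n + k, v, ?_⟩
    ext t
    simp [T, smul_smul, pow_add]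
  exact hle hg

theorem bilin_mem_polyFun (β : U →ₗ[F] V →ₗ[F] Z) {g : F → U} {h : F → V}
    (hg : g ∈ polyFun F U) (hh : h ∈ polyFun F V) : (fun t => β (g t) (h t)) ∈ polyFun F Z := by
  let T : (F → U) →ₗ[F] (F → Z) :=
    { toFun := fun g t => β (g t) (h t)
      map_add' := fun a b => by ext t; simp
      map_smul' := fun c a => by ext t; simp }
  have hle : polyFun F U ≤ (polyFun F Z).comap T := by
    refine Submodule.span_le.mpr ?_
    rintro _ ⟨n, u, rfl⟩
    have := pow_smul_mem_polyFun n (linear_mem_polyFun (β u) hh)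
    simpa [T] using this
  exact hle hg

theorem exists_eval_of_mem_polyFun {g : F → F} (hg : g ∈ polyFun F F) :
    ∃ P : F[X], ∀ t, P.eval t = g t := by
  induction hg using Submodule.span_induction with
  | mem g hg =>
    obtain ⟨n, u, rfl⟩ := hg
    exact ⟨X ^ n * C u, fun t => by simp only [eval_mul, eval_pow, eval_X, eval_C, smul_eq_mul]⟩
  | zero => exact ⟨0, by simp⟩
  | add a b _ _ ha hb =>
    obtain ⟨P, hP⟩ := ha
    obtain ⟨Q, hQ⟩ := hb
    exact ⟨P + Q, by simp [hP, hQ]⟩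
  | smul c a _ ha =>
    obtain ⟨P, hP⟩ := ha
    exact ⟨C c * P, by simp [hP]⟩

/-- Linear independence is an open condition in polynomial families. -/
theorem exists_polynomial_linearIndependent {ι : Type*} [Fintype ι] [DecidableEq ι]
    {g : ι → F → V} (hg : ∀ i, g i ∈ polyFun F V) {t₀ : F}
    (h : LinearIndependent F fun i => g i t₀) :
    ∃ P : F[X], P ≠ 0 ∧ ∀ t, P.eval t ≠ 0 → LinearIndependent F fun i => g i t := by
  rw [linearIndependent_iff_injective_fintypeLinearCombination] at h
  -- The coordinates `ψ` send the family at `t₀` to the standard basis, so the determinant below is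
  -- a polynomial with value 1 at `t₀`.
  obtain ⟨ψ, hψ⟩ := LinearMap.exists_leftInverse_of_injective _ (LinearMap.ker_eq_bot.mpr h)
  have hψ' : ∀ i, ψ (g i t₀) = Pi.single i 1 := fun i => by
    simpa using LinearMap.congr_fun hψ (Pi.single i 1)
  choose P hP using fun i j => exists_eval_of_mem_polyFun
    (linear_mem_polyFun (LinearMap.proj j ∘ₗ ψ) (hg i))
  have heval : ∀ t, (Matrix.of P).det.eval t = (Matrix.of fun i j => ψ (g i t) j).det := by
    intro t
    rw [← coe_evalRingHom, RingHom.map_det]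
    congr 1
    ext i j
    simp [hP]
  refine ⟨(Matrix.of P).det, ?_, fun t ht => ?_⟩
  · intro h0
    have h1 := heval t₀
    have h2 : (Matrix.of fun i j => ψ (g i t₀) j) = 1 := by
      ext i j
      simp [hψ', Matrix.one_apply, Pi.single_apply, eq_comm]
    rw [h0, h2] at h1
    simp at h1
  · rw [heval] at ht
    exact LinearIndependent.of_comp ψ (Matrix.linearIndependent_rows_of_det_ne_zero ht)

end PolyFun

/-! ### Semicontinuity of the dimension of the derived algebra -/

section Semicontinuity

theorem pi_mem_polyFun {F : Type*} [Field F] {n : ℕ} {g : F → Fin n → F}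
    (hg : ∀ i, (fun t => g t i) ∈ polyFun F F) : g ∈ polyFun F (Fin n → F) := by
  have h : g = ∑ i, fun t => LinearMap.single F (fun _ : Fin n => F) i (g t i) := by
    ext t j
    simp [Finset.sum_apply, Pi.single_apply]
  rw [h]
  exact sum_mem fun i _ => linear_mem_polyFun _ (hg i)

variable {F V : Type*} [Field F] [LieRing V] [LieAlgebra F V]

theorem lie_mem_polyFun {g h : F → V} (hg : g ∈ polyFun F V) (hh : h ∈ polyFun F V) :
    (fun t => ⁅g t, h t⁆) ∈ polyFun F V :=
  bilin_mem_polyFun (LieModule.toEnd F V V : V →ₗ[F] End F V) hg hh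

/-- Replacing `y` by `(1 - t) • y + t • z` in a Lie expression deforms its value polynomially in
`t`. -/
theorem exists_lift_of_mem_lieSpan (x y z : V) {a : V}
    (ha : a ∈ LieSubalgebra.lieSpan F V {x, y}) :
    ∃ g ∈ polyFun F V, g 0 = a ∧
      ∀ t : F, g t ∈ LieSubalgebra.lieSpan F V {x, (1 - t) • y + t • z} := by
  let K : LieSubalgebra F V :=
    { carrier := {a | ∃ g ∈ polyFun F V, g 0 = a ∧
        ∀ t : F, g t ∈ LieSubalgebra.lieSpan F V {x, (1 - t) • y + t • z}}
      add_mem' := by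
        rintro _ _ ⟨g, hg, rfl, hg'⟩ ⟨h, hh, rfl, hh'⟩
        exact ⟨g + h, add_mem hg hh, rfl, fun t => add_mem (hg' t) (hh' t)⟩
      zero_mem' := ⟨0, zero_mem _, rfl, fun t => zero_mem _⟩
      smul_mem' := by
        rintro c _ ⟨g, hg, rfl, hg'⟩
        exact ⟨c • g, Submodule.smul_mem _ c hg, rfl, fun t => LieSubalgebra.smul_mem _ c (hg' t)⟩
      lie_mem' := by
        rintro _ _ ⟨g, hg, rfl, hg'⟩ ⟨h, hh, rfl, hh'⟩
        exact ⟨_, lie_mem_polyFun hg hh, rfl, fun t => LieSubalgebra.lie_mem _ (hg' t) (hh' t)⟩ }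
  have hK : LieSubalgebra.lieSpan F V {x, y} ≤ K := by
    rw [LieSubalgebra.lieSpan_le]
    rintro u (hu | hu)
    · exact ⟨_, const_mem_polyFun u, rfl, fun t => LieSubalgebra.subset_lieSpan (.inl hu)⟩
    · rw [Set.mem_singleton_iff.mp hu]
      exact ⟨_, line_mem_polyFun y z, by simp, fun t => LieSubalgebra.subset_lieSpan (by simp)⟩
  exact hK ha

theorem exists_lift_of_mem_bracketSpan (x y z : V) {a : V} (ha : a ∈ bracketSpan F x y) :
    ∃ g ∈ polyFun F V, g 0 = a ∧ ∀ t : F, g t ∈ bracketSpan F x ((1 - t) • y + t • z) := by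
  induction ha using Submodule.span_induction with
  | mem a ha =>
    obtain ⟨u, hu, v, hv, rfl⟩ := ha
    obtain ⟨g, hg, rfl, hg'⟩ := exists_lift_of_mem_lieSpan x y z hu
    obtain ⟨h, hh, rfl, hh'⟩ := exists_lift_of_mem_lieSpan x y z hv
    exact ⟨_, lie_mem_polyFun hg hh, rfl,
      fun t => Submodule.subset_span ⟨_, hg' t, _, hh' t, rfl⟩⟩
  | zero => exact ⟨0, zero_mem _, rfl, fun t => zero_mem _⟩
  | add a b _ _ ha hb =>
    obtain ⟨g, hg, rfl, hg'⟩ := ha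
    obtain ⟨h, hh, rfl, hh'⟩ := hb
    exact ⟨g + h, add_mem hg hh, rfl, fun t => add_mem (hg' t) (hh' t)⟩
  | smul c a _ ha =>
    obtain ⟨g, hg, rfl, hg'⟩ := ha
    exact ⟨c • g, Submodule.smul_mem _ c hg, rfl, fun t => Submodule.smul_mem _ c (hg' t)⟩

/-- On a line, the dimension of the derived algebra is bounded by its generic value. -/
theorem finrank_bracketSpan_le_of_generic [Infinite F] [FiniteDimensional F V] (x y z : V) (n : ℕ)
    (P : F[X]) (hP : P ≠ 0)
    (h : ∀ t, P.eval t ≠ 0 → finrank F (bracketSpan F x ((1 - t) • y + t • z)) ≤ n) :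
    finrank F (bracketSpan F x y) ≤ n := by
  by_contra! hlt
  obtain ⟨v, hv⟩ := exists_linearIndependent_of_le_finrank (Nat.succ_le_of_lt hlt)
  choose g hg hg0 hgt using fun i => exists_lift_of_mem_bracketSpan x y z (v i).2
  have hind : LinearIndependent F fun i => g i 0 := by
    simp only [hg0]
    exact hv.map' (bracketSpan F x y).subtype (Submodule.ker_subtype _)
  obtain ⟨Q, hQ, hQt⟩ := exists_polynomial_linearIndependent hg hind
  -- At such a `t` the generic bound holds, yet `n + 1` independent lifted elements survive.
  obtain ⟨t, ht⟩ : ∃ t, (P * Q).eval t ≠ 0 := by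
    by_contra! hcon
    exact mul_ne_zero hP hQ (Polynomial.funext fun t => by simpa using hcon t)
  rw [eval_mul] at ht
  have hind' : LinearIndependent F fun i => (⟨g i t, hgt i t⟩ :
      bracketSpan F x ((1 - t) • y + t • z)) :=
    LinearIndependent.of_comp (Submodule.subtype _) (hQt t (right_ne_zero_of_mul ht))
  have h1 := hind'.fintype_card_le_finrank
  have h2 := h t (left_ne_zero_of_mul ht)
  simp only [Fintype.card_fin] at h1
  omega

end Semicontinuity

/-! ### Jets along a line of derivations, and products of eigenvectors -/

section JetGeneric

variable {F B : Type*} [Field F] [CommRing B] [Algebra F B]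

theorem iterate_mem_polyFun (y z : Derivation F B B) (i : ℕ) (b : B) :
    (fun t : F => (((1 - t) • y + t • z : Derivation F B B) : End F B) ^ i • b) ∈
      polyFun F B := by
  let β : Derivation F B B →ₗ[F] B →ₗ[F] B :=
    LinearMap.mk₂ F (fun D b => D b) (fun _ _ _ => rfl) (fun _ _ _ => rfl)
      (fun D b c => map_add D b c) (fun c D b => D.map_smul c b)
  induction i with
  | zero => simpa using const_mem_polyFun b
  | succ i ih =>
    have := bilin_mem_polyFun β (line_mem_polyFun y z) ih
    simp only [pow_succ', mul_smul]
    exact this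

/-- Injectivity of jets is an open condition on a line of derivations. -/
theorem exists_polynomial_jet_injective [FiniteDimensional F B] (ε : B →ₐ[F] F) (n : ℕ)
    (y z : Derivation F B B) (hz : Function.Injective (jet ε n z)) :
    ∃ P : F[X], P ≠ 0 ∧ ∀ t, P.eval t ≠ 0 →
      Function.Injective (jet ε n ((1 - t) • y + t • z)) := by
  have b := Module.finBasis F B
  have hg : ∀ j, (fun t : F => jet ε n ((1 - t) • y + t • z) (b j)) ∈ polyFun F (Fin n → F) :=
    fun j => pi_mem_polyFun fun i =>
      linear_mem_polyFun ε.toLinearMap (iterate_mem_polyFun y z i (b j))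
  have h1 : LinearIndependent F fun j => jet ε n ((1 - (1 : F)) • y + (1 : F) • z) (b j) := by
    simp only [sub_self, zero_smul, one_smul, zero_add]
    exact b.linearIndependent.map' _ (LinearMap.ker_eq_bot.mpr hz)
  obtain ⟨P, hP, hPt⟩ := exists_polynomial_linearIndependent hg h1
  refine ⟨P, hP, fun t ht => ?_⟩
  rw [injective_iff_map_eq_zero]
  intro f hf
  have h2 := Fintype.linearIndependent_iff.mp (hPt t ht) (b.repr f) (by
    rw [← hf]
    conv_rhs => rw [← b.sum_repr f]
    simp only [map_sum, map_smul])
  rw [← b.sum_repr f]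
  simp [h2]

theorem apply_prod_pow_of_eigen {ι : Type*} (D : Derivation F B B) (u : ι → B) (c : ι → F)
    (h : ∀ i, D (u i) = c i • u i) (a : ι → ℕ) (s : Finset ι) :
    D (∏ i ∈ s, u i ^ a i) = (∑ i ∈ s, c i * a i) • ∏ i ∈ s, u i ^ a i := by
  classical
  induction s using Finset.induction_on with
  | empty => simp
  | insert i s hi ih =>
    have hpow : D (u i ^ a i) = (c i * a i) • u i ^ a i := by
      rw [Derivation.leibniz_pow, h]
      cases a i with
      | zero => simp
      | succ k =>
        simp only [Nat.add_sub_cancel, Algebra.smul_def (R := F) (A := B), pow_succ,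
          nsmul_eq_mul, smul_eq_mul, map_mul, map_natCast]
        ring
    rw [Finset.prod_insert hi, Finset.sum_insert hi, Derivation.leibniz, ih, hpow]
    simp only [Algebra.smul_def (R := F) (A := B), smul_eq_mul, map_add]
    ring

end JetGeneric

/-- Over an infinite field of characteristic `p` there are weights `lam` with pairwise distinct
values `∑ lam j * a j` for `0 ≤ a j < p`. -/
theorem exists_separating_weights (F : Type*) [Field F] [Infinite F] (p m : ℕ) [CharP F p] :
    ∃ lam : Fin m → F,
      Function.Injective fun a : Fin m → Fin p => ∑ j, lam j * ((a j : ℕ) : F) := by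
  classical
  -- The weights will be `lam j = t ^ j`, with `t` avoiding the roots of all differences of distinct
  -- `Q a`. Diagonal pairs contribute a factor 1.
  let Q : (Fin m → Fin p) → F[X] := fun a => ∑ j : Fin m, C ((a j : ℕ) : F) * X ^ (j : ℕ)
  have hQ : Function.Injective Q := by
    intro a b hab
    ext j
    have hc : ∀ a, (Q a).coeff j = ((a j : ℕ) : F) := fun a => by
      simp [Q, coeff_X_pow, Fin.val_inj]
    have hj := congrArg (fun q : F[X] => q.coeff j) hab
    simp only [hc] at hj
    exact CharP.natCast_injOn_Iio F p (a j).2 (b j).2 hj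
  obtain ⟨t, ht⟩ : ∃ t, (∏ ab : (Fin m → Fin p) × (Fin m → Fin p),
      if ab.1 = ab.2 then (1 : F[X]) else Q ab.1 - Q ab.2).eval t ≠ 0 := by
    by_contra! hcon
    have h0 := Polynomial.funext (q := 0) fun t => by simpa using hcon t
    rw [Finset.prod_eq_zero_iff] at h0
    obtain ⟨ab, -, h⟩ := h0
    split_ifs at h with hab
    · exact one_ne_zero h
    · exact hab (hQ (sub_eq_zero.mp h))
  refine ⟨fun j => t ^ (j : ℕ), fun a b hab => ?_⟩
  by_contra hne
  rw [eval_prod, Finset.prod_ne_zero_iff] at ht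
  have h := ht (a, b) (Finset.mem_univ _)
  rw [if_neg hne, eval_sub, sub_ne_zero] at h
  apply h
  simp only [Q, eval_finsetSum, eval_mul, eval_C, eval_pow, eval_X]
  simpa [mul_comm] using hab

/-! ### The truncated polynomial ring -/

section Trunc

variable (F : Type*) [Field F] (p m : ℕ)

/-- The generators `x_i` of the truncated polynomial ring. -/
def gen (i : Fin m) : TruncPoly F p m := Ideal.Quotient.mk (truncIdeal F p m) (MvPolynomial.X i)

theorem gen_pow (i : Fin m) : gen F p m i ^ p = 0 := by
  rw [gen, ← map_pow, Ideal.Quotient.eq_zero_iff_mem]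
  exact Ideal.subset_span ⟨i, rfl⟩

theorem mono_eq_prod (a : Fin m → ℕ) : mono F p a = ∏ i, gen F p m i ^ a i := rfl

variable {F p m} in
theorem truncPoly_induction {C : TruncPoly F p m → Prop} (hC : ∀ r, C (algebraMap F _ r))
    (hadd : ∀ a b, C a → C b → C (a + b)) (hmul : ∀ a i, C a → C (a * gen F p m i)) (b) : C b := by
  obtain ⟨f, rfl⟩ := Ideal.Quotient.mk_surjective b
  induction f using MvPolynomial.induction_on with
  | C r => exact hC r
  | add f g hf hg => rw [map_add]; exact hadd _ _ hf hg
  | mul_X f i hf => rw [map_mul]; exact hmul _ i hf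

theorem derivation_eq_zero (D : Witt F p m) (h : ∀ i, D (gen F p m i) = 0) : D = 0 := by
  ext b
  induction b using truncPoly_induction with
  | hC r => simp
  | hadd a b ha hb => simp [map_add, ha, hb]
  | hmul a i ha => simp [Derivation.leibniz, ha, h]

theorem mono_eq_zero {a : Fin m → ℕ} {i : Fin m} (hi : p ≤ a i) : mono F p a = 0 := by
  rw [mono_eq_prod]
  refine Finset.prod_eq_zero (Finset.mem_univ i) ?_
  rw [← Nat.sub_add_cancel hi, pow_add, gen_pow, mul_zero]

theorem mono_mul_gen (a : Fin m → ℕ) (i : Fin m) :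
    mono F p a * gen F p m i = mono F p (a + Pi.single i 1) := by
  simp only [mono_eq_prod, Pi.add_apply, pow_add, Finset.prod_mul_distrib]
  congr 1
  rw [Finset.prod_eq_single i]
  · simp
  · intro j _ hj
    simp [Pi.single_eq_of_ne hj]
  · simp

theorem span_mono_eq_top :
    Submodule.span F (Set.range fun a : Fin m → Fin p => mono F p fun i => (a i : ℕ)) = ⊤ := by
  have hmem : ∀ a : Fin m → ℕ, mono F p a ∈
      Submodule.span F (Set.range fun a : Fin m → Fin p => mono F p fun i => (a i : ℕ)) := by
    intro a
    by_cases h : ∀ i, a i < p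
    · exact Submodule.subset_span ⟨fun i => ⟨a i, h i⟩, rfl⟩
    · push Not at h
      obtain ⟨i, hi⟩ := h
      rw [mono_eq_zero F p m hi]
      exact zero_mem _
  rw [eq_top_iff]
  rintro b -
  induction b using truncPoly_induction with
  | hC r =>
    have h1 : (algebraMap F (TruncPoly F p m) r) = r • mono F p 0 := by
      rw [mono_eq_prod]
      simpa using Algebra.algebraMap_eq_smul_one (A := TruncPoly F p m) r
    rw [h1]
    exact Submodule.smul_mem _ _ (hmem _)
  | hadd a b ha hb => exact add_mem ha hb
  | hmul b i hb =>
    induction hb using Submodule.span_induction with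
    | mem b hb =>
      obtain ⟨a, rfl⟩ := hb
      simp only [mono_mul_gen]
      exact hmem _
    | zero => simp
    | add a b _ _ ha hb => rw [add_mul]; exact add_mem ha hb
    | smul c a _ ha => rw [smul_mul_assoc]; exact Submodule.smul_mem _ c ha

instance : FiniteDimensional F (TruncPoly F p m) :=
  ⟨⟨(Set.finite_range _).toFinset, by
    rw [Set.Finite.coe_toFinset]; exact span_mono_eq_top F p m⟩⟩

instance : FiniteDimensional F (Witt F p m) := by
  let coord : Witt F p m →ₗ[F] (Fin m → TruncPoly F p m) :=
    { toFun := fun D i => D (gen F p m i)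
      map_add' := fun _ _ => rfl
      map_smul' := fun _ _ => rfl }
  refine FiniteDimensional.of_injective coord ?_
  rw [injective_iff_map_eq_zero]
  exact fun D hD => derivation_eq_zero F p m D fun i => congrFun hD i

theorem finrank_truncPoly_le : finrank F (TruncPoly F p m) ≤ p ^ m := by
  have h := finrank_range_le_card (R := F)
    fun a : Fin m → Fin p => mono F p fun i => (a i : ℕ)
  rw [Set.finrank, span_mono_eq_top, finrank_top] at h
  simpa using h

/-! ### Augmentation, socle and a toral derivation with injective jet -/

section Augmentation

variable [Fact p.Prime]

/-- The augmentation of the truncated polynomial ring, with `x_i ↦ 0`. -/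
def augment : TruncPoly F p m →ₐ[F] F :=
  Ideal.Quotient.liftₐ (truncIdeal F p m) (MvPolynomial.aeval fun _ => 0) (by
    have hle : truncIdeal F p m ≤
        RingHom.ker (MvPolynomial.aeval (R := F) fun _ : Fin m => (0 : F)) := by
      refine Ideal.span_le.mpr ?_
      rintro _ ⟨i, rfl⟩
      simp [RingHom.mem_ker, (Fact.out : p.Prime).ne_zero]
    exact fun a ha => hle ha)

theorem augment_gen (i : Fin m) : augment F p m (gen F p m i) = 0 := by
  refine (Ideal.Quotient.lift_mk _ _ _).trans ?_
  simp

instance : Nontrivial (TruncPoly F p m) := (augment F p m).toRingHom.domain_nontrivial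

theorem isUnit_of_augment_ne_zero (b : TruncPoly F p m) (hb : augment F p m b ≠ 0) :
    IsUnit b := by
  have hnil : b - algebraMap F _ (augment F p m b) ∈ nilradical (TruncPoly F p m) := by
    clear hb
    induction b using truncPoly_induction with
    | hC r => simp
    | hadd a b ha hb =>
      have := add_mem ha hb
      rw [map_add, map_add]
      convert this using 1
      ring
    | hmul b i hb =>
      rw [map_mul, augment_gen, mul_zero, map_zero, sub_zero]
      exact Ideal.mul_mem_left _ _ ⟨p, gen_pow F p m i⟩
  have hu : IsUnit (algebraMap F (TruncPoly F p m) (augment F p m b)) :=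
    (IsUnit.mk0 _ hb).map _
  have := IsNilpotent.isUnit_add_left_of_commute (mem_nilradical.mp hnil) hu (Commute.all _ _)
  simpa using this

/-- Every generator annihilates the top monomial, so only the constant term of `b` acts. -/
theorem top_mono_mul (b : TruncPoly F p m) :
    mono F p (fun _ : Fin m => p - 1) * b = augment F p m b • mono F p (fun _ : Fin m => p - 1) := by
  induction b using truncPoly_induction with
  | hC r => 
    rw [AlgHom.commutes, mul_comm]
    exact (Algebra.smul_def _ _).symm
  | hadd a b ha hb => rw [mul_add, ha, hb, map_add, add_smul]
  | hmul b i hb =>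
    rw [map_mul, augment_gen, mul_zero, zero_smul, mul_comm b, ← mul_assoc, mono_mul_gen,
      mono_eq_zero F p m (i := i), zero_mul]
    simp only [Pi.add_apply, Pi.single_eq_same]
    omega

variable [CharP F p]

omit [Fact p.Prime] in
theorem partialD_gen (i j : Fin m) :
    partialD F p m j (gen F p m i) = if i = j then 1 else 0 := by
  rw [gen, partialD_mk, MvPolynomial.pderiv_X]
  by_cases h : i = j
  · subst h; simp
  · simp [h]

/-- The toral derivation `∑ lam_j (1 + x_j) D_j`. -/
def toral (lam : Fin m → F) : Witt F p m :=
  ∑ j, lam j • ((1 + gen F p m j) • partialD F p m j)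

omit [Fact p.Prime] in
theorem toral_apply (lam : Fin m → F) (b : TruncPoly F p m) :
    toral F p m lam b = ∑ j, lam j • ((1 + gen F p m j) * partialD F p m j b) := by
  rw [toral, ← Derivation.coeFnAddMonoidHom_apply, map_sum, Finset.sum_apply]
  rfl

omit [Fact p.Prime] in
theorem toral_one_add_gen (lam : Fin m → F) (i : Fin m) :
    toral F p m lam (1 + gen F p m i) = lam i • (1 + gen F p m i) := by
  simp [toral_apply, partialD_gen]

/-- The products of powers of `1 + x_i` are eigenvectors of `z` with distinct eigenvalues, hence a
basis, which gives the exact dimension. Using `1 + x_i` instead of `x_i` gives each augmentation 1,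
so the jet matrix in this basis is Vandermonde. -/
theorem exists_toral_jet_injective [Infinite F] :
    finrank F (TruncPoly F p m) = p ^ m ∧
      ∃ z : Witt F p m, Function.Injective (jet (augment F p m) (p ^ m) z) := by
  obtain ⟨lam, hlam⟩ := exists_separating_weights F p m
  set z := toral F p m lam with hz
  set e : (Fin m → Fin p) → TruncPoly F p m := fun a => ∏ i, (1 + gen F p m i) ^ (a i : ℕ)
    with he
  set w : (Fin m → Fin p) → F := fun a => ∑ j, lam j * ((a j : ℕ) : F) with hw
  have heig : ∀ a, z (e a) = w a • e a := fun a =>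
    apply_prod_pow_of_eigen z _ lam (toral_one_add_gen F p m lam) _ _
  have haug : ∀ a, augment F p m (e a) = 1 := fun a => by
    simp [he, augment_gen]
  have hli : LinearIndependent F e := by
    refine Module.End.eigenvectors_linearIndependent' (z : End F (TruncPoly F p m)) w hlam e
      fun a => ⟨Module.End.mem_eigenspace_iff.mpr (heig a), fun h0 => ?_⟩
    have := haug a
    rw [h0, map_zero] at this
    exact zero_ne_one this
  have hcard : Fintype.card (Fin m → Fin p) = p ^ m := by simp
  have hdim : finrank F (TruncPoly F p m) = p ^ m := by
    refine le_antisymm (finrank_truncPoly_le F p m) ?_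
    rw [← hcard]
    exact hli.fintype_card_le_finrank
  refine ⟨hdim, z, ?_⟩
  have : Nonempty (Fin m → Fin p) := ⟨fun _ => ⟨0, (Fact.out : p.Prime).pos⟩⟩
  let b := basisOfLinearIndependentOfCardEqFinrank hli (hcard.trans hdim.symm)
  have hb : ∀ a, b a = e a := fun a => by simp [b]
  have hiter : ∀ (n : ℕ) a, ((z : End F (TruncPoly F p m)) ^ n) (e a) = w a ^ n • e a := by
    intro n a
    induction n with
    | zero => simp
    | succ n ih =>
      rw [pow_succ', Module.End.mul_apply, ih, map_smul, Derivation.coeFn_coe, heig, smul_smul,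
        pow_succ]
  rw [injective_iff_map_eq_zero]
  intro f hf
  let σ := Fintype.equivFinOfCardEq hcard
  have hsum : ∀ i : Fin (p ^ m),
      ∑ j : Fin (p ^ m), b.repr f (σ.symm j) * w (σ.symm j) ^ (i : ℕ) = 0 := by
    intro i
    have hi := congrFun hf i
    rw [jet_apply, ← b.sum_repr f] at hi
    simp only [map_sum, map_smul, hb, hiter, haug, smul_eq_mul, mul_one, Pi.zero_apply] at hi
    rw [← hi]
    exact Equiv.sum_comp σ.symm fun a => b.repr f a * w a ^ (i : ℕ)
  have hzero := Matrix.eq_zero_of_forall_pow_sum_mul_pow_eq_zero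
    (f := fun j => w (σ.symm j)) (hlam.comp σ.symm.injective) hsum
  rw [← b.sum_repr f]
  refine Finset.sum_eq_zero fun a _ => ?_
  have ha := congrFun hzero (σ a)
  simp only [Equiv.symm_apply_apply, Pi.zero_apply] at ha
  rw [ha, zero_smul]

theorem exists_eq_top_mono_smul (x : Witt F p m) (hx : x ∈ component F p m (topDegree p m)) :
    ∃ D : Witt F p m, x = mono F p (fun _ : Fin m => p - 1) • D := by
  induction hx using Submodule.span_induction with
  | mem x hx =>
    obtain ⟨a, j, ha, rfl⟩ := hx
    -- The exponents sum to `m (p - 1)`: either all equal `p - 1`, or one is at least `p` and the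
    -- monomial vanishes.
    by_cases h : ∀ i, a i ≤ p - 1
    · refine ⟨partialD F p m j, ?_⟩
      have hp := (Fact.out : p.Prime).one_lt
      have hsum : ∑ i, a i = ∑ _i : Fin m, (p - 1) := by
        rw [Finset.sum_const, Finset.card_univ, Fintype.card_fin, smul_eq_mul]
        zify [hp.le]
        rw [topDegree] at ha
        push_cast at ha
        linarith
      have heq := (Finset.sum_eq_sum_iff_of_le fun i _ => h i).mp hsum
      have : a = fun _ => p - 1 := funext fun i => heq i (Finset.mem_univ i)
      rw [this]
    · push Not at h
      obtain ⟨i, hi⟩ := h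
      exact ⟨0, by rw [mono_eq_zero F p m (i := i) (by omega)]; ext b; simp⟩
  | zero => exact ⟨0, by simp⟩
  | add a b _ _ ha hb =>
    obtain ⟨D, rfl⟩ := ha
    obtain ⟨E, rfl⟩ := hb
    exact ⟨D + E, by rw [smul_add]⟩
  | smul c a _ ha =>
    obtain ⟨D, rfl⟩ := ha
    exact ⟨c • D, by rw [smul_comm]⟩

theorem finrank_bracketSpan_le [Infinite F] (x y : Witt F p m)
    (hx : x ∈ component F p m (topDegree p m)) : finrank F (bracketSpan F x y) ≤ p ^ m := by
  obtain ⟨D, rfl⟩ := exists_eq_top_mono_smul F p m x hx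
  obtain ⟨hdim, z, hz⟩ := exists_toral_jet_injective F p m
  obtain ⟨P, hP, hPt⟩ := exists_polynomial_jet_injective (augment F p m) (p ^ m) y z hz
  refine finrank_bracketSpan_le_of_generic _ y z _ P hP fun t ht => ?_
  exact finrank_bracketSpan_le_of_jet p (isUnit_of_augment_ne_zero F p m) hdim (gen F p m)
    (derivation_eq_zero F p m) _ (top_mono_mul F p m) D _ (hPt t ht)

end Augmentation

end Trunc

/-! ### From the bracket span to the derived algebra -/

theorem finrank_derivedAlg_lieSpan_le {F V : Type*} [Field F] [LieRing V] [LieAlgebra F V]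
    [FiniteDimensional F V] (x y : V) :
    finrank F (derivedAlg F (LieSubalgebra.lieSpan F V {x, y})) ≤ finrank F (bracketSpan F x y) := by
  set L := LieSubalgebra.lieSpan F V {x, y} with hL
  have hle : (derivedAlg F L).toSubmodule ≤
      (bracketSpan F x y).comap (L.toSubmodule.subtype) := by
    rw [LieSubmodule.lieIdeal_oper_eq_linear_span', Submodule.span_le]
    rintro _ ⟨a, -, b, -, rfl⟩
    exact Submodule.subset_span ⟨a, a.2, b, b.2, rfl⟩
  exact LinearMap.finrank_le_finrank_of_injective
    (f := (L.toSubmodule.subtype).restrict hle) fun a b hab =>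
      Subtype.ext (Subtype.ext (congrArg (fun c : bracketSpan F x y => (c : V)) hab))

end WittAlg

end

theorem mainTheorem7 {F : Type*} [Field F] [IsAlgClosed F] (p : ℕ) [CharP F p] (hp : 3 < p)
    (m : ℕ) (hm : 1 ≤ m) (x y : WittAlg.Witt F p m)
    (hx : x ∈ WittAlg.component F p m (WittAlg.topDegree p m)) :
    Module.Finite F
        (WittAlg.derivedAlg F (LieSubalgebra.lieSpan F (WittAlg.Witt F p m) {x, y})) ∧
      Module.finrank F
        (WittAlg.derivedAlg F (LieSubalgebra.lieSpan F (WittAlg.Witt F p m) {x, y})) ≤ p ^ m := by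
  have hprime : Fact p.Prime :=
    ⟨(CharP.char_is_prime_or_zero F p).resolve_right (by omega)⟩
  have : Infinite F := IsAlgClosed.instInfinite
  exact ⟨inferInstance, (WittAlg.finrank_derivedAlg_lieSpan_le x y).trans
    (WittAlg.finrank_bracketSpan_le F p m x y hx)⟩
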